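/- Let $T\ge 0$, $p\ge 1$, $n=\lfloor p\rfloor$, and let $W=(W_t)_{t\in[0,T]}$ be a real-valued stochastic process on a probability space. Assume that, almost surely, the path of $W$ is càdlàg on $[0,T]$, has finite $p$-variation on $[0,T]$, and takes its values in a compact interval $[m,M]\subset(0,\infty)$ (which may depend on the path). Write $W_{s,t}=W_t-W_s$, $W_{t-}=\lim_{u\uparrow t}W_u$ and $\Delta_t^-W=W_t-W_{t-}$. For $q>0$, a real function $\Xi$ of $0\le s\le t\le T$ has finite $q$-variation if $\sup_\Pi\sum_{[s,t]\in\Pi}|\Xi_{s,t}|^q<\infty$ over partitions $\Pi$ of $[0,T]$, and a path does if its increments do. A limit $\mathrm{RRS}\text{-}\lim_{\Pi}\sum_{[s,t]\in\Pi}\Xi_{s,t}=K$ means: for every $\varepsilon>0$ there is a partition $\Pi_\varepsilon$ of $[0,T]$ such that $|\sum_{[s,t]\in\Pi}\Xi_{s,t}-K|<\varepsilon$ for every partition $\Pi$ refining $\Pi_\varepsilon$. A real reduced rough path of finite $p$-variation is a family $\mathbb X=(1,\mathbb X^1,\dots,\mathbb X^n)$ of real functions of $0\le s\le t\le T$ with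 $\mathbb X^k_{s,t}=\sum_{j=0}^k\mathbb X^{k-j}_{s,u}\mathbb X^j_{u,t}$ for $s\le u\le t$ and $\sum_{k=1}^n|\mathbb X^k_{s,t}|^{p/k}\le c(s,t)$ for some $c\ge 0$ with $c(t,t)=0$ and $c(s,u)+c(u,t)\le c(s,t)$. A family $Y=(Y^0,\dots,Y^{n-1})$ of real functions on $[0,T]$ is $\mathbb X$-controlled if, for $0\le i\le n-1$, $R^i_{s,t}=Y^i_t-Y^i_s-\sum_{j=1}^{n-1-i}Y^{i+j}_s\mathbb X^j_{s,t}$ has finite $\frac{p}{n-i}$-variation. In that case the reduced rough integral is $\int_0^T Y\,d\mathbb X=\mathrm{RRS}\text{-}\lim_{\Pi}\sum_{[s,t]\in\Pi}\sum_{k=0}^{n-1}Y^k_s\,\mathbb X^{k+1}_{s,t}$, if the limit exists. Then, almost surely, $\mathbf W=(1,W,\tfrac1{2!}W^{2},\dots,\tfrac1{n!}W^{n})$, that is $\mathbf W^k_{s,t}=\frac{1}{k!}(W_{s,t})^k$, is a reduced rough path of finite $p$-variation; the family $Y^k_t=(D^{k+1}\log)(W_t)=\frac{(-1)^k k!}{W_t^{k+1}}$,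 $0\le k\le n-1$, is $\mathbf W$-controlled; the reduced rough integral $\int_0^T\frac1{W_t}\,d\mathbf W_t:=\int_0^T Y\,d\mathbf W$ exists; the sum below converges absolutely; and $$\log W_T-\log W_0=\int_0^T\frac{1}{W_t}\,d\mathbf W_t+\sum_{0<t\le T}\left(\log\Bigl(1+\frac{\Delta_t^-W}{W_{t-}}\Bigr)-\sum_{k=1}^{\lfloor p\rfloor}\frac{(-1)^{k-1}}{k}\Bigl(\frac{\Delta_t^-W}{W_{t-}}\Bigr)^k\right).$$ -/

import Mathlib

open MeasureTheory Filter Topology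
open scoped ENNReal

/-- A partition `0 = t_0 < t_1 < ⋯ < t_N = T` of `[0, T]`. -/
structure IntervalPartition (T : ℝ) where
  N : ℕ
  t : Fin (N + 1) → ℝ
  strictMono : StrictMono t
  first : t 0 = 0
  last : t (Fin.last N) = T

namespace IntervalPartition

/-- `π.Refines π₀` : every point of `π₀` is a point of `π`. -/
def Refines {T : ℝ} (π π₀ : IntervalPartition T) : Prop :=
  Set.range π₀.t ⊆ Set.range π.t

end IntervalPartition

/-- The Riemann sum `∑_{[u,v] ∈ π} Ξ_{u,v}`. -/
noncomputable def riemannSum {T : ℝ} (Ξ : ℝ → ℝ → ℝ) (π : IntervalPartition T) : ℝ :=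
  ∑ i : Fin π.N, Ξ (π.t i.castSucc) (π.t i.succ)

/-- The sums `∑_{[u,v] ∈ π} Ξ_{u,v}` converge to `K` in the refinement Riemann–Stieltjes sense. -/
def HasRRSLimit (T : ℝ) (Ξ : ℝ → ℝ → ℝ) (K : ℝ) : Prop :=
  ∀ ε : ℝ, 0 < ε → ∃ π₀ : IntervalPartition T, ∀ π : IntervalPartition T, π.Refines π₀ →
    |riemannSum Ξ π - K| < ε

theorem IntervalPartition.exists_common_refinement {T : ℝ} (π₁ π₂ : IntervalPartition T) :
    ∃ π : IntervalPartition T, π.Refines π₁ ∧ π.Refines π₂ := by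
  classical
  let S : Finset ℝ := Finset.univ.image π₁.t ∪ Finset.univ.image π₂.t
  have hmem : ∀ x, x ∈ S ↔ x ∈ Set.range π₁.t ∨ x ∈ Set.range π₂.t := by
    intro x; simp [S]
  have h0 : (0 : ℝ) ∈ S := (hmem 0).2 (Or.inl ⟨0, π₁.first⟩)
  have hTm : T ∈ S := (hmem T).2 (Or.inl ⟨_, π₁.last⟩)
  have bd : ∀ (π : IntervalPartition T) (i), 0 ≤ π.t i ∧ π.t i ≤ T := fun π i =>
    ⟨π.first.symm.trans_le (π.strictMono.monotone (Fin.zero_le i)),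
      (π.strictMono.monotone (Fin.le_last i)).trans_eq π.last⟩
  have hb : ∀ x ∈ S, 0 ≤ x ∧ x ≤ T := by
    intro x hx
    rcases (hmem x).1 hx with ⟨i, rfl⟩ | ⟨i, rfl⟩
    · exact bd π₁ i
    · exact bd π₂ i
  obtain ⟨n, hn⟩ : ∃ n, S.card = n + 1 :=
    Nat.exists_eq_succ_of_ne_zero (Finset.card_pos.2 ⟨0, h0⟩).ne'
  have hr : Set.range (S.orderEmbOfFin hn) = (S : Set ℝ) := Finset.range_orderEmbOfFin S hn
  refine ⟨⟨n, S.orderEmbOfFin hn, (S.orderEmbOfFin hn).strictMono, ?_, ?_⟩, ?_, ?_⟩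
  · obtain ⟨i, hi⟩ : (0 : ℝ) ∈ Set.range (S.orderEmbOfFin hn) := by rw [hr]; exact h0
    refine le_antisymm ?_ (hb _ (Finset.orderEmbOfFin_mem S hn 0)).1
    have := (S.orderEmbOfFin hn).monotone (Fin.zero_le i)
    rwa [hi] at this
  · obtain ⟨i, hi⟩ : T ∈ Set.range (S.orderEmbOfFin hn) := by rw [hr]; exact hTm
    refine le_antisymm (hb _ (Finset.orderEmbOfFin_mem S hn _)).2 ?_
    have := (S.orderEmbOfFin hn).monotone (Fin.le_last i)
    rwa [hi] at this
  · intro x hx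
    change x ∈ Set.range (S.orderEmbOfFin hn)
    rw [hr]; exact (hmem x).2 (Or.inl hx)
  · intro x hx
    change x ∈ Set.range (S.orderEmbOfFin hn)
    rw [hr]; exact (hmem x).2 (Or.inr hx)

/-- Refinement Riemann–Stieltjes limits are unique. -/
theorem HasRRSLimit.unique {T : ℝ} {Ξ : ℝ → ℝ → ℝ} {K L : ℝ} (hK : HasRRSLimit T Ξ K)
    (hL : HasRRSLimit T Ξ L) : K = L := by
  by_contra hne
  have hpos : 0 < |K - L| := abs_pos.2 (sub_ne_zero.2 hne)
  obtain ⟨π₁, h₁⟩ := hK (|K - L| / 2) (by linarith)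
  obtain ⟨π₂, h₂⟩ := hL (|K - L| / 2) (by linarith)
  obtain ⟨π, hπ₁, hπ₂⟩ := π₁.exists_common_refinement π₂
  have e₁ := h₁ π hπ₁
  have e₂ := h₂ π hπ₂
  have e₃ := abs_sub_le K (riemannSum Ξ π) L
  rw [abs_sub_comm K (riemannSum Ξ π)] at e₃
  linarith

/-- The `p`-variation (`0 < p < ∞`) over `[0, T]` of a function of two parameters `s ≤ t`. -/
noncomputable def pVariation (p T : ℝ) (Ξ : ℝ → ℝ → ℝ) : ℝ≥0∞ :=
  (⨆ π : IntervalPartition T, ∑ i : Fin π.N, ‖Ξ (π.t i.castSucc) (π.t i.succ)‖ₑ ^ p) ^ (1 / p)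

/-- The increments `X_{s,t} = X_t - X_s` of a path. -/
def increment (X : ℝ → ℝ) (s t : ℝ) : ℝ := X t - X s

/-- Right-continuous with left limits on `[0, T]`. Only the values of `X` on `[0, T]` matter. -/
def IsCadlagOn (T : ℝ) (X : ℝ → ℝ) : Prop :=
  (∀ t, 0 ≤ t → t < T → Tendsto X (𝓝[>] t) (𝓝 (X t))) ∧
  (∀ t, 0 < t → t ≤ T → ∃ l : ℝ, Tendsto X (𝓝[<] t) (𝓝 l))

/-- The left jump `Δ_t^- X = X_t - X_{t-}`, where `X_{t-} = Function.leftLim X t`. -/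
noncomputable def leftJump (X : ℝ → ℝ) (t : ℝ) : ℝ := X t - Function.leftLim X t

/-- A (jump) control function on `{(s, t) | 0 ≤ s ≤ t ≤ T}`; no continuity is required. -/
structure IsControl (T : ℝ) (c : ℝ → ℝ → ℝ) : Prop where
  nonneg : ∀ s t, 0 ≤ s → s ≤ t → t ≤ T → 0 ≤ c s t
  diag : ∀ t, 0 ≤ t → t ≤ T → c t t = 0
  superadd : ∀ s u t, 0 ≤ s → s ≤ u → u ≤ t → t ≤ T → c s u + c u t ≤ c s t

/-- A reduced rough path of finite `p`-variation over the space `V = ℝ`. The spaces `Sym_k(ℝ)` are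
all identified with `ℝ`, tensor products becoming products and `Sym` the identity, so that a
reduced rough path is a family of real functions `x k s t`, `k = 0, …, ⌊p⌋`. -/
structure IsReducedRoughPath (p T : ℝ) (x : ℕ → ℝ → ℝ → ℝ) : Prop where
  zero : ∀ s t, 0 ≤ s → s ≤ t → t ≤ T → x 0 s t = 1
  control : ∃ c : ℝ → ℝ → ℝ, IsControl T c ∧ ∀ s t, 0 ≤ s → s ≤ t → t ≤ T →
    ∑ k ∈ Finset.Icc 1 ⌊p⌋₊, |x k s t| ^ (p / (k : ℝ)) ≤ c s t
  chen : ∀ k, k ≤ ⌊p⌋₊ → ∀ s u t, 0 ≤ s → s ≤ u → u ≤ t → t ≤ T →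
    x k s t = ∑ j ∈ Finset.range (k + 1), x (k - j) s u * x j u t

/-- The canonical lift `𝕏^k_{s,t} = X_{s,t}^{⊗ k} / k!` of a path. -/
noncomputable def reducedLift (X : ℝ → ℝ) (k : ℕ) (s t : ℝ) : ℝ :=
  increment X s t ^ k / (k.factorial : ℝ)

/-- The remainder `R^i_{s,t} = Y^i_t - Y^i_s - ∑_{j=1}^{⌊p⌋-1-i} Y^{i+j}_s 𝕏^j_{s,t}`
(for `i = ⌊p⌋ - 1` the sum is empty). -/
noncomputable def controlledRemainder (p : ℝ) (x : ℕ → ℝ → ℝ → ℝ) (Y : ℕ → ℝ → ℝ) (i : ℕ)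
    (s t : ℝ) : ℝ :=
  Y i t - Y i s - ∑ j ∈ Finset.Icc 1 (⌊p⌋₊ - 1 - i), Y (i + j) s * x j s t

/-- `Y = (Y^0, …, Y^{⌊p⌋-1})` is a reduced `x`-controlled path: each remainder `R^i` has finite
`p / (⌊p⌋ - i)`-variation. The values in `L(Sym_i(ℝ), L(ℝ, ℝ))` are identified with reals. -/
def IsReducedControlledPath (p T : ℝ) (x : ℕ → ℝ → ℝ → ℝ) (Y : ℕ → ℝ → ℝ) : Prop :=
  ∀ i, i < ⌊p⌋₊ →
    pVariation (p / ((⌊p⌋₊ : ℝ) - (i : ℝ))) T (controlledRemainder p x Y i) < ∞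

/-- `K` is the reduced rough integral `∫_0^T Y d𝕏`: `x` is a reduced rough path, `Y` is
`x`-controlled, and the compensated sums `∑_{[s,t]} ∑_{k < ⌊p⌋} Y^k_s 𝕏^{k+1}_{s,t}` converge to
`K` in the refinement Riemann–Stieltjes sense. -/
structure HasReducedRoughIntegral (p T : ℝ) (x : ℕ → ℝ → ℝ → ℝ) (Y : ℕ → ℝ → ℝ) (K : ℝ) :
    Prop where
  roughPath : IsReducedRoughPath p T x
  controlled : IsReducedControlledPath p T x Y
  limit : HasRRSLimit T (fun s t => ∑ k ∈ Finset.range ⌊p⌋₊, Y k s * x (k + 1) s t) K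

/-- The path `(DF(X), D²F(X), …)`, with `k`-th component `D^{k+1}F(X_t)`. For `F = log` and a
positive path `X` its component of index `0` is `1 / X_t`. -/
noncomputable def gradientPath (F : ℝ → ℝ) (X : ℝ → ℝ) (k : ℕ) (t : ℝ) : ℝ :=
  iteratedDeriv (k + 1) F (X t)

theorem gradientPath_log_zero (X : ℝ → ℝ) (t : ℝ) : gradientPath Real.log X 0 t = 1 / X t := by
  simp [gradientPath, iteratedDeriv_one]

/-- The jump correction
`log (1 + Δ_t^- X / X_{t-}) - ∑_{k=1}^{⌊p⌋} (-1)^{k-1} / k * (Δ_t^- X / X_{t-})^k`. -/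
noncomputable def logJumpCorrection (p : ℝ) (X : ℝ → ℝ) (t : ℝ) : ℝ :=
  Real.log (1 + leftJump X t / Function.leftLim X t) -
    ∑ k ∈ Finset.Icc 1 ⌊p⌋₊,
      (-1 : ℝ) ^ (k - 1) / (k : ℝ) * (leftJump X t / Function.leftLim X t) ^ k

/-!
The statement is a pathwise Itô formula, so a single path `X` is fixed.

Finite `p`-variation gives a nondecreasing function `v` with `|X_{s,t}|^p ≤ v t - v s`
(`exists_isVariationControl`). Taylor's theorem with uniform constants (`exists_taylor_bound`)
bounds the remainders `R^i` of the gradient path by `C |X_{s,t}|^(⌊p⌋ - i)`, hence their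
`p / (⌊p⌋ - i)`-th powers by a multiple of `v t - v s`; so the gradient path is controlled.

For the integral, write `log X_T - log X_0` as a telescoping sum over a partition and expand each
term: the compensated Riemann sum equals `log X_T - log X_0` minus the sum of the Taylor remainders
`g (X_s, X_t)`, which are of order `⌊p⌋ + 1 > p`. It remains to find the limit of these sums
(`exists_hasSum_hasRRSLimit_of_abs_le`). A càdlàg path has increments at most `δ` over all intervals
`(s, t]` that avoid a finite set `F` (`IsCadlagOn.exists_finset_abs_sub_le`). Once the partition
contains `F`, the intervals not ending in `F` contribute at most
`C δ^(⌊p⌋ + 1 - p) (v T - v 0)`, and an interval ending at `t ∈ F` contributes nearly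
`g (X_{t-}, X_t)` when its left end is close to `t`. The jumps are `p`-summable
(`IsCadlagOn.sum_abs_leftJump_rpow_le`), so the sum of `g (X_{t-}, X_t)` over all `t` converges
absolutely and is the limit. For the logarithm, `g (X_{t-}, X_t)` is the stated jump correction
(`logJumpCorrection_eq`).
-/

/-! ### Partitions and variation controls -/

namespace IntervalPartition

variable {T : ℝ}

theorem nonneg (π : IntervalPartition T) (i : Fin (π.N + 1)) : 0 ≤ π.t i :=
  π.first.symm.trans_le (π.strictMono.monotone (Fin.zero_le i))

theorem le_right (π : IntervalPartition T) (i : Fin (π.N + 1)) : π.t i ≤ T :=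
  (π.strictMono.monotone (Fin.le_last i)).trans_eq π.last

theorem castSucc_lt_succ (π : IntervalPartition T) (i : Fin π.N) :
    π.t i.castSucc < π.t i.succ :=
  π.strictMono Fin.castSucc_lt_succ

/-- The trivial partition of the degenerate interval `[0, 0]`. -/
def zero : IntervalPartition 0 where
  N := 0
  t := fun _ => 0
  strictMono := fun i j h => absurd h (by omega)
  first := rfl
  last := rfl

/-- The partition of `[0, T']` obtained from one of `[0, T]` by adding the point `T' > T`. -/
def snoc {T T' : ℝ} (π : IntervalPartition T) (h : T < T') : IntervalPartition T' where
  N := π.N + 1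
  t := Fin.snoc π.t T'
  strictMono := by
    refine Fin.strictMono_iff_lt_succ.2 fun i => ?_
    refine Fin.lastCases ?_ (fun j => ?_) i
    · rw [Fin.succ_last, Fin.snoc_last, Fin.snoc_castSucc, π.last]
      exact h
    · rw [Fin.succ_castSucc, Fin.snoc_castSucc, Fin.snoc_castSucc]
      exact π.castSucc_lt_succ j
  first := by
    have : (0 : Fin (π.N + 1 + 1)) = Fin.castSucc 0 := rfl
    rw [this, Fin.snoc_castSucc, π.first]
  last := by rw [Fin.snoc_last]

theorem range_snoc {T T' : ℝ} (π : IntervalPartition T) (h : T < T') :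
    Set.range (π.snoc h).t = insert T' (Set.range π.t) :=
  Fin.range_snoc π.t T'

theorem riemannSum_snoc {T T' : ℝ} (π : IntervalPartition T) (h : T < T') (Ξ : ℝ → ℝ → ℝ) :
    riemannSum Ξ (π.snoc h) = riemannSum Ξ π + Ξ T T' := by
  have : riemannSum Ξ (π.snoc h) = ∑ i : Fin (π.N + 1),
      Ξ (Fin.snoc (α := fun _ => ℝ) π.t T' i.castSucc)
        (Fin.snoc (α := fun _ => ℝ) π.t T' i.succ) := rfl
  rw [this, Fin.sum_univ_castSucc]
  simp only [Fin.succ_last, Fin.snoc_last, Fin.snoc_castSucc, Fin.succ_castSucc, π.last]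
  rfl

theorem nonempty (hT : 0 ≤ T) : Nonempty (IntervalPartition T) := by
  rcases hT.eq_or_lt with rfl | h
  · exact ⟨zero⟩
  · exact ⟨zero.snoc h⟩

theorem exists_finset_subset_range (hT : 0 ≤ T) (S : Finset ℝ) (hS : ∀ x ∈ S, x ∈ Set.Icc 0 T) :
    ∃ π : IntervalPartition T, (S : Set ℝ) ⊆ Set.range π.t := by
  classical
  induction S using Finset.induction_on with
  | empty => obtain ⟨π⟩ := nonempty hT; exact ⟨π, by simp⟩
  | insert x S _ ih =>
    obtain ⟨π₁, h₁⟩ := ih fun y hy => hS y (Finset.mem_insert_of_mem hy)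
    obtain ⟨π₂, h₂⟩ : ∃ π : IntervalPartition T, x ∈ Set.range π.t := by
      obtain ⟨h0, hxT⟩ := hS x (Finset.mem_insert_self x S)
      obtain ⟨π⟩ := nonempty h0
      have hx : x ∈ Set.range π.t := ⟨_, π.last⟩
      rcases hxT.eq_or_lt with rfl | h
      · exact ⟨π, hx⟩
      · exact ⟨π.snoc h, by rw [range_snoc]; exact Or.inr hx⟩
    obtain ⟨π, hπ₁, hπ₂⟩ := π₁.exists_common_refinement π₂
    refine ⟨π, ?_⟩
    rw [Finset.coe_insert]
    exact Set.insert_subset (hπ₂ h₂) (h₁.trans hπ₁)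

/-- Sums of increments over a partition telescope. -/
theorem sum_sub (π : IntervalPartition T) (v : ℝ → ℝ) :
    ∑ i : Fin π.N, (v (π.t i.succ) - v (π.t i.castSucc)) = v T - v 0 := by
  have h₁ := Fin.sum_univ_succ fun i => v (π.t i)
  have h₂ := Fin.sum_univ_castSucc fun i => v (π.t i)
  rw [π.first] at h₁
  rw [π.last] at h₂
  rw [Finset.sum_sub_distrib]
  linarith

end IntervalPartition

/-- `v` controls the `p`-variation of `X` on `[0, T]`: the additive control
`(s, t) ↦ v t - v s` dominates `|X_{s,t}|^p`. -/
def IsVariationControl (p T : ℝ) (X v : ℝ → ℝ) : Prop :=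
  ∀ s t, 0 ≤ s → s ≤ t → t ≤ T → |X t - X s| ^ p ≤ v t - v s

theorem IsVariationControl.monotone {p T : ℝ} {X v : ℝ → ℝ} (hv : IsVariationControl p T X v)
    {s t : ℝ} (hs : 0 ≤ s) (hst : s ≤ t) (ht : t ≤ T) : v s ≤ v t :=
  sub_nonneg.1 <| (Real.rpow_nonneg (abs_nonneg _) p).trans (hv s t hs hst ht)

/-- Finiteness of the `p`-variation bounds the sums `∑ |Ξ_{s,t}|^p` uniformly. -/
theorem exists_riemannSum_le_of_pVariation_lt_top {p T : ℝ} (hp : 0 < p) {Ξ : ℝ → ℝ → ℝ}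
    (h : pVariation p T Ξ < ∞) :
    ∃ V : ℝ, ∀ π : IntervalPartition T, riemannSum (fun s t => |Ξ s t| ^ p) π ≤ V := by
  have hfin := (ENNReal.rpow_lt_top_iff_of_pos (one_div_pos.2 hp)).1 h
  refine ⟨_, fun π => (ENNReal.ofReal_le_iff_le_toReal hfin.ne).1 ?_⟩
  refine le_trans (le_of_eq ?_) (le_iSup _ π)
  rw [riemannSum, ENNReal.ofReal_sum_of_nonneg fun i _ => by positivity]
  refine Finset.sum_congr rfl fun i _ => ?_
  rw [← ENNReal.ofReal_rpow_of_nonneg (abs_nonneg _) hp.le, Real.enorm_eq_ofReal_abs]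

/-- A two-parameter function whose `q`-th power is dominated by an additive control has finite
`q`-variation. -/
theorem pVariation_lt_top_of_le {q T K : ℝ} (hq : 0 < q) {Ξ : ℝ → ℝ → ℝ} {v : ℝ → ℝ}
    (h : ∀ s t, 0 ≤ s → s ≤ t → t ≤ T → |Ξ s t| ^ q ≤ K * (v t - v s)) :
    pVariation q T Ξ < ∞ := by
  refine (ENNReal.rpow_lt_top_iff_of_pos (one_div_pos.2 hq)).2 ?_
  refine lt_of_le_of_lt (iSup_le fun π => ?_) (ENNReal.ofReal_lt_top (r := K * (v T - v 0)))
  rw [← π.sum_sub v, Finset.mul_sum]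
  have key : ∀ i : Fin π.N, |Ξ (π.t i.castSucc) (π.t i.succ)| ^ q ≤
      K * (v (π.t i.succ) - v (π.t i.castSucc)) := fun i =>
    h _ _ (π.nonneg _) (π.castSucc_lt_succ i).le (π.le_right _)
  rw [ENNReal.ofReal_sum_of_nonneg fun i _ => le_trans (by positivity) (key i)]
  refine Finset.sum_le_sum fun i _ => ?_
  rw [Real.enorm_eq_ofReal_abs, ENNReal.ofReal_rpow_of_nonneg (abs_nonneg _) hq.le]
  exact ENNReal.ofReal_le_ofReal (key i)

/-- A path of finite `p`-variation is controlled by `v t`, its `p`-variation sums over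
partitions of `[0, t]` maximised: appending `t` to a partition of `[0, s]` gives
`v s + |X_{s,t}|^p ≤ v t`. -/
theorem exists_isVariationControl {p T : ℝ} (hp : 0 < p) {X : ℝ → ℝ}
    (h : pVariation p T (increment X) < ∞) : ∃ v, IsVariationControl p T X v := by
  set Ξ : ℝ → ℝ → ℝ := fun s t => |increment X s t| ^ p with hΞ
  obtain ⟨V, hV⟩ := exists_riemannSum_le_of_pVariation_lt_top hp h
  have hΞ0 : ∀ s t, 0 ≤ Ξ s t := fun s t => Real.rpow_nonneg (abs_nonneg _) p
  have hV' : ∀ t ≤ T, ∀ π : IntervalPartition t, riemannSum Ξ π ≤ V := by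
    intro t ht π
    rcases ht.eq_or_lt with rfl | hlt
    · exact hV π
    · have := hV (π.snoc hlt)
      rw [π.riemannSum_snoc hlt] at this
      linarith [hΞ0 t T]
  have hbdd : ∀ t ≤ T, BddAbove (Set.range fun π : IntervalPartition t => riemannSum Ξ π) :=
    fun t ht => ⟨V, by rintro _ ⟨π, rfl⟩; exact hV' t ht π⟩
  refine ⟨fun t => ⨆ π : IntervalPartition t, riemannSum Ξ π, fun s t hs hst ht => ?_⟩
  rcases hst.eq_or_lt with rfl | hlt
  · simp [Real.zero_rpow hp.ne']
  · rw [le_sub_iff_add_le, ← le_sub_iff_add_le']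
    have := IntervalPartition.nonempty hs
    refine ciSup_le fun π => ?_
    have := le_ciSup (hbdd t ht) (π.snoc hlt)
    rw [π.riemannSum_snoc hlt] at this
    exact le_sub_iff_add_le.2 this

/-! ### Taylor remainders -/

/-- Taylor's estimate with a constant uniform in both the base point and the end point. The
derivatives are given as a sequence `D`, so that it applies to every `D i` at once. -/
theorem exists_taylor_bound {D : ℕ → ℝ → ℝ} {m M : ℝ}
    (hD : ∀ k, ∀ x ∈ Set.Icc m M, HasDerivAt (D k) (D (k + 1) x) x) (N i : ℕ) :
    ∃ C, 0 ≤ C ∧ ∀ x ∈ Set.Icc m M, ∀ y ∈ Set.Icc m M,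
      |D i y - ∑ j ∈ Finset.range N, D (i + j) x * ((y - x) ^ j / (j.factorial : ℝ))|
        ≤ C * |y - x| ^ N := by
  induction N generalizing i with
  | zero =>
    have hc : ContinuousOn (D i) (Set.Icc m M) := fun x hx =>
      (hD i x hx).continuousAt.continuousWithinAt
    obtain ⟨C, hC⟩ := isCompact_Icc.exists_bound_of_continuousOn hc
    refine ⟨max C 0, le_max_right _ _, fun x _ y hy => ?_⟩
    simpa using Or.inl (hC y hy)
  | succ N ih =>
    obtain ⟨C, hC0, hC⟩ := ih (i + 1)
    refine ⟨C, hC0, fun x hx y hy => ?_⟩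
    -- The remainder vanishes at `y = x`, and its derivative in `y` is the remainder of order `N`
    -- of the derivative: the mean value inequality on the segment applies.
    set φ : ℝ → ℝ := fun z =>
      D i z - ∑ j ∈ Finset.range (N + 1), D (i + j) x * ((z - x) ^ j / (j.factorial : ℝ)) with hφ
    set φ' : ℝ → ℝ := fun z =>
      D (i + 1) z - ∑ j ∈ Finset.range N, D (i + 1 + j) x * ((z - x) ^ j / (j.factorial : ℝ))
      with hφ'
    have hsub : Set.uIcc x y ⊆ Set.Icc m M := Set.uIcc_subset_Icc hx hy
    have hder : ∀ z ∈ Set.uIcc x y, HasDerivWithinAt φ (φ' z) (Set.uIcc x y) z := by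
      intro z hz
      refine HasDerivAt.hasDerivWithinAt ?_
      refine (hD i z (hsub hz)).sub ?_
      simp only [Finset.sum_range_succ' _ N]
      have hs : HasDerivAt (fun z => ∑ j ∈ Finset.range N,
          D (i + (j + 1)) x * ((z - x) ^ (j + 1) / ((j + 1).factorial : ℝ)))
          (∑ j ∈ Finset.range N, D (i + 1 + j) x * ((z - x) ^ j / (j.factorial : ℝ))) z := by
        refine HasDerivAt.fun_sum fun j _ => ?_
        have h := ((((hasDerivAt_id z).sub_const x).pow (j + 1)).div_const
          ((j + 1).factorial : ℝ)).const_mul (D (i + (j + 1)) x)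
        refine h.congr_deriv ?_
        rw [Nat.factorial_succ, add_right_comm i 1 j, add_assoc i j 1]
        push_cast
        have : ((j : ℝ) + 1) ≠ 0 := by positivity
        have : (j.factorial : ℝ) ≠ 0 := by positivity
        simp only [id, mul_one]
        field_simp
      simpa using hs
    have hbound : ∀ z ∈ Set.uIcc x y, ‖φ' z‖ ≤ C * |y - x| ^ N := by
      intro z hz
      refine (hC x hx z (hsub hz)).trans ?_
      gcongr C * ?_ ^ N
      exact Set.abs_sub_left_of_mem_uIcc hz
    have := (convex_uIcc x y).norm_image_sub_le_of_norm_hasDerivWithin_le hder hbound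
      Set.left_mem_uIcc Set.right_mem_uIcc
    have hx0 : φ x = 0 := by
      simp [hφ, Finset.sum_range_succ' _ N]
    rw [hx0, sub_zero, Real.norm_eq_abs, Real.norm_eq_abs, mul_assoc, ← pow_succ] at this
    exact this

theorem iteratedDeriv_succ_real_log (k : ℕ) (x : ℝ) :
    iteratedDeriv (k + 1) Real.log x = (-1) ^ k * (k.factorial : ℝ) * x ^ (-1 - k : ℤ) := by
  rw [iteratedDeriv_succ', Real.deriv_log', iteratedDeriv_eq_iterate, iter_deriv_inv]

theorem hasDerivAt_iteratedDeriv_log (k : ℕ) {x : ℝ} (hx : 0 < x) :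
    HasDerivAt (iteratedDeriv k Real.log) (iteratedDeriv (k + 1) Real.log x) x := by
  rw [iteratedDeriv_succ]
  refine DifferentiableAt.hasDerivAt ?_
  cases k with
  | zero => simpa using hx.ne'
  | succ k =>
    rw [funext (iteratedDeriv_succ_real_log k)]
    exact (differentiableAt_zpow.2 (Or.inl hx.ne')).const_mul _

/-! ### Càdlàg paths and their jumps -/

namespace IsCadlagOn

variable {T : ℝ} {X : ℝ → ℝ}

theorem tendsto_leftLim (hX : IsCadlagOn T X) {t : ℝ} (h0 : 0 < t) (hT : t ≤ T) :
    Tendsto X (𝓝[<] t) (𝓝 (Function.leftLim X t)) :=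
  tendsto_leftLim_of_tendsto (hX.2 t h0 hT)

theorem tendsto_sub_leftJump (hX : IsCadlagOn T X) {t : ℝ} (h0 : 0 < t) (hT : t ≤ T) :
    Tendsto (fun s => |X t - X s|) (𝓝[<] t) (𝓝 |leftJump X t|) :=
  (tendsto_const_nhds.sub (hX.tendsto_leftLim h0 hT)).abs

theorem leftLim_mem (hX : IsCadlagOn T X) {S : Set ℝ} (hS : IsClosed S)
    (hXS : ∀ t ∈ Set.Icc 0 T, X t ∈ S) {t : ℝ} (h0 : 0 < t) (hT : t ≤ T) :
    Function.leftLim X t ∈ S := by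
  refine hS.mem_of_tendsto (hX.tendsto_leftLim h0 hT) ?_
  filter_upwards [Ioo_mem_nhdsLT h0] with s hs
  exact hXS s ⟨hs.1.le, hs.2.le.trans hT⟩

/-- Away from finitely many points, the increments of a càdlàg path are small: an increment over
`[s, t]` exceeds `δ` only if `(s, t]` meets a fixed finite set. -/
theorem exists_finset_abs_sub_le (hX : IsCadlagOn T X) {δ : ℝ} (hδ : 0 < δ) :
    ∃ F : Finset ℝ, ∀ s t, 0 ≤ s → s < t → t ≤ T → (∀ x ∈ F, x ∉ Set.Ioc s t) →
      |X t - X s| ≤ δ := by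
  classical
  -- Only the left end `s` is localised: the right end of the neighbourhood is put into `F`, which
  -- keeps `t` in the same neighbourhood as `s`.
  have key : ∃ F : Finset ℝ, ∀ s ∈ Set.Icc 0 T, ∀ t, s < t → t ≤ T →
      (∀ x ∈ F, x ∉ Set.Ioc s t) → |X t - X s| ≤ δ := by
    refine isCompact_Icc.induction_on
      (p := fun A => ∃ F : Finset ℝ, ∀ s ∈ A, ∀ t, s < t → t ≤ T →
        (∀ x ∈ F, x ∉ Set.Ioc s t) → |X t - X s| ≤ δ) ⟨∅, by simp⟩ ?_ ?_ ?_
    · rintro A B hAB ⟨F, hF⟩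
      exact ⟨F, fun s hs => hF s (hAB hs)⟩
    · rintro A B ⟨F, hF⟩ ⟨G, hG⟩
      refine ⟨F ∪ G, fun s hs t hst ht h => ?_⟩
      rcases hs with hs | hs
      · exact hF s hs t hst ht fun x hx => h x (Finset.mem_union_left _ hx)
      · exact hG s hs t hst ht fun x hx => h x (Finset.mem_union_right _ hx)
    · rintro x ⟨hx0, hxT⟩
      have hball : ∀ l : ℝ, Metric.closedBall l (δ / 2) ∈ 𝓝 l := fun l =>
        Metric.closedBall_mem_nhds l (half_pos hδ)
      obtain ⟨a, hax, l, hl⟩ : ∃ a < x, ∃ l, ∀ s ∈ Set.Ioo a x, 0 ≤ s → |X s - l| ≤ δ / 2 := by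
        rcases hx0.eq_or_lt with rfl | hpos
        · exact ⟨-1, by norm_num, 0, fun s hs h => absurd hs.2 h.not_gt⟩
        · obtain ⟨l, hl⟩ := hX.2 x hpos hxT
          obtain ⟨a, ha, h⟩ := mem_nhdsLT_iff_exists_Ioo_subset.1 (hl (hball l))
          exact ⟨a, ha, l, fun s hs _ => h hs⟩
      obtain ⟨b, hxb, hb⟩ : ∃ b > x, ∀ s ∈ Set.Ico x b, s ≤ T → |X s - X x| ≤ δ / 2 := by
        rcases hxT.eq_or_lt with rfl | hlt
        · refine ⟨x + 1, by linarith, fun s hs h => ?_⟩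
          rw [le_antisymm h hs.1]
          simpa using (half_pos hδ).le
        · obtain ⟨b, hb, h⟩ := mem_nhdsGT_iff_exists_Ioo_subset.1 (hX.1 x hx0 hlt (hball (X x)))
          refine ⟨b, hb, fun s hs _ => ?_⟩
          rcases hs.1.eq_or_lt with rfl | hxs
          · simpa using (half_pos hδ).le
          · exact h ⟨hxs, hs.2⟩
      refine ⟨Set.Icc 0 T ∩ Set.Ioo a b, inter_mem_nhdsWithin _ (Ioo_mem_nhds hax hxb), {x, b},
        fun s hs t hst ht h => ?_⟩
      have htb : t < b := by
        by_contra! hbt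
        exact h b (by simp) ⟨hs.2.2, hbt⟩
      rcases lt_or_ge s x with hsx | hxs
      · have htx : t < x := by
          by_contra! hxt
          exact h x (by simp) ⟨hsx, hxt⟩
        have h1 := abs_le.1 (hl s ⟨hs.2.1, hsx⟩ hs.1.1)
        have h2 := abs_le.1 (hl t ⟨hs.2.1.trans hst, htx⟩ (hs.1.1.trans hst.le))
        exact abs_le.2 ⟨by linarith, by linarith⟩
      · have h1 := abs_le.1 (hb s ⟨hxs, hs.2.2⟩ hs.1.2)
        have h2 := abs_le.1 (hb t ⟨hxs.trans hst.le, htb⟩ ht)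
        exact abs_le.2 ⟨by linarith, by linarith⟩
  obtain ⟨F, hF⟩ := key
  exact ⟨F, fun s t hs hst ht => hF s ⟨hs, hst.le.trans ht⟩ t hst ht⟩

/-- The jumps of a path are `p`-summable, with sums bounded by the control. -/
theorem sum_abs_leftJump_rpow_le (hX : IsCadlagOn T X) {p : ℝ} (hp : 0 < p) {v : ℝ → ℝ}
    (hv : IsVariationControl p T X v) (F : Finset ℝ) {r : ℝ} (hr0 : 0 ≤ r) (hrT : r ≤ T)
    (hF : ∀ t ∈ F, t ∈ Set.Ioc 0 r) :
    ∑ t ∈ F, |leftJump X t| ^ p ≤ v r - v 0 := by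
  classical
  induction F using Finset.induction_on_max generalizing r with
  | empty => simpa using hv.monotone le_rfl hr0 hrT
  | insert a F hmax ih =>
    obtain ⟨ha0, har⟩ := hF a (Finset.mem_insert_self a F)
    have haT : a ≤ T := har.trans hrT
    refine le_trans ?_ (sub_le_sub_right (hv.monotone ha0.le har hrT) _)
    rw [Finset.sum_insert fun h => lt_irrefl a (hmax a h)]
    -- For `s < a` close to `a`, all other points of the finite set lie in `(0, s]`.
    refine le_of_tendsto (((hX.tendsto_sub_leftJump ha0 haT).rpow_const
      (Or.inr hp.le)).add_const _) ?_
    have hev : ∀ᶠ s in 𝓝[<] a, ∀ x ∈ F, x ≤ s := by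
      rw [Filter.eventually_all_finset]
      intro x hx
      filter_upwards [Ioo_mem_nhdsLT (hmax x hx)] with s hs using hs.1.le
    filter_upwards [Ioo_mem_nhdsLT ha0, hev] with s hs hFs
    have h1 := hv s a hs.1.le hs.2.le haT
    have h2 := ih hs.1.le (hs.2.le.trans haT)
      fun t ht => ⟨(hF t (Finset.mem_insert_of_mem ht)).1, hFs t ht⟩
    linarith

end IsCadlagOn

/-! ### Riemann sums of terms of order higher than the variation -/

theorem rpow_abs_le_of_abs_le {p q δ x : ℝ} (hp : 0 < p) (hpq : p < q) (hx : |x| ≤ δ) :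
    |x| ^ q ≤ δ ^ (q - p) * |x| ^ p := by
  have h : |x| ^ q = |x| ^ (q - p) * |x| ^ p := by
    rw [← Real.rpow_add' (abs_nonneg x) (by linarith), sub_add_cancel]
  rw [h]
  gcongr

/-- Riemann sums of a function `g` of order `q > p` along a càdlàg path of finite `p`-variation
see only the jumps of the path: they converge to `∑ g (X_{t-}, X_t)`. -/
theorem exists_hasSum_hasRRSLimit_of_abs_le {p q T C m M : ℝ} (hT : 0 ≤ T) (hp : 0 < p)
    (hpq : p < q) (hC : 0 ≤ C) {X v : ℝ → ℝ} (hX : IsCadlagOn T X)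
    (hv : IsVariationControl p T X v) (hXS : ∀ t ∈ Set.Icc 0 T, X t ∈ Set.Icc m M)
    {g : ℝ → ℝ → ℝ}
    (hg : ∀ x ∈ Set.Icc m M, ∀ y ∈ Set.Icc m M, |g x y| ≤ C * |y - x| ^ q)
    (hgc : ∀ y ∈ Set.Icc m M, ContinuousOn (fun x => g x y) (Set.Icc m M)) :
    ∃ J, HasSum (fun t : Set.Ioc 0 T => g (Function.leftLim X t) (X t)) J ∧
      HasRRSLimit T (fun s t => g (X s) (X t)) J := by
  classical
  set j : ℝ → ℝ := fun t => g (Function.leftLim X t) (X t) with hj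
  set V : ℝ := v T - v 0 with hV
  have hV0 : 0 ≤ V := sub_nonneg.2 (hv.monotone le_rfl hT le_rfl)
  have hIcc : ∀ t ∈ Set.Ioc 0 T, X t ∈ Set.Icc m M := fun t ht => hXS t ⟨ht.1.le, ht.2⟩
  have hlim : ∀ t ∈ Set.Ioc 0 T, Function.leftLim X t ∈ Set.Icc m M := fun t ht =>
    hX.leftLim_mem isClosed_Icc hXS ht.1 ht.2
  have hjle : ∀ δ, ∀ t ∈ Set.Ioc 0 T, |leftJump X t| ≤ δ →
      |j t| ≤ C * δ ^ (q - p) * |leftJump X t| ^ p := by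
    intro δ t ht hδ
    refine (hg _ (hlim t ht) _ (hIcc t ht)).trans ?_
    rw [mul_assoc]
    exact mul_le_mul_of_nonneg_left (rpow_abs_le_of_abs_le hp hpq hδ) hC
  have hjump : ∀ F : Finset (Set.Ioc 0 T), ∑ t ∈ F, |leftJump X t| ^ p ≤ V := by
    intro F
    have := hX.sum_abs_leftJump_rpow_le hp hv (F.map (Function.Embedding.subtype _)) hT le_rfl
      (by
        intro t ht
        obtain ⟨x, _, rfl⟩ := Finset.mem_map.1 ht
        exact x.2)
    simpa [Finset.sum_map] using this
  have hsum : Summable fun t : Set.Ioc 0 T => j t := by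
    refine Summable.of_abs (Summable.of_nonneg_of_le (fun _ => abs_nonneg _)
      (fun t => hjle (M - m) t t.2 ?_)
      ((summable_of_sum_le (fun _ => by positivity) hjump).mul_left _))
    have h1 := hlim t t.2
    have h2 := hIcc t t.2
    exact abs_le.2 ⟨by linarith [h1.2, h2.1, leftJump.eq_def X t],
      by linarith [h1.1, h2.2, leftJump.eq_def X t]⟩
  obtain ⟨J, hJ⟩ := hsum
  refine ⟨J, hJ, fun ε hε => ?_⟩
  -- Increments of size at most `δ` contribute at most `ε / 4` in total.
  obtain ⟨δ, hδ, hδε⟩ : ∃ δ > 0, C * δ ^ (q - p) * V < ε / 4 := by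
    have h : Tendsto (fun δ : ℝ => C * δ ^ (q - p) * V) (𝓝[>] 0) (𝓝 0) := by
      have h := ((Real.continuous_rpow_const (sub_pos.2 hpq).le).tendsto 0).const_mul C
      have h' := (h.mul_const V).mono_left (nhdsWithin_le_nhds (s := Set.Ioi (0 : ℝ)))
      rwa [Real.zero_rpow (sub_pos.2 hpq).ne', mul_zero, zero_mul] at h'
    obtain ⟨δ, h1, h2⟩ := ((h.eventually_lt_const (by positivity : (0 : ℝ) < ε / 4)).and
      self_mem_nhdsWithin).exists
    exact ⟨δ, h2, h1⟩
  obtain ⟨F₀, hF₀⟩ := hX.exists_finset_abs_sub_le hδ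
  set F : Finset (Set.Ioc 0 T) := F₀.subtype (· ∈ Set.Ioc 0 T) with hFdef
  have hF : ∀ s t, 0 ≤ s → s < t → t ≤ T → (∀ x : Set.Ioc 0 T, x ∈ F → (x : ℝ) ∉ Set.Ioc s t) →
      |X t - X s| ≤ δ := by
    intro s t hs hst ht h
    refine hF₀ s t hs hst ht fun x hx hxst => ?_
    exact h ⟨x, hs.trans_lt hxst.1, hxst.2.trans ht⟩ (Finset.mem_subtype.2 hx) hxst
  have hsmall : ∀ t : Set.Ioc 0 T, t ∉ F → |leftJump X t| ≤ δ := by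
    intro t ht
    refine le_of_tendsto (hX.tendsto_sub_leftJump t.2.1 t.2.2) ?_
    have hev : ∀ᶠ s in 𝓝[<] (t : ℝ), ∀ x ∈ F, (x : ℝ) ∉ Set.Ioc s (t : ℝ) := by
      rw [Filter.eventually_all_finset]
      intro x hx
      rcases lt_trichotomy (x : ℝ) t with h | h | h
      · filter_upwards [Ioo_mem_nhdsLT (a := (x : ℝ)) (b := t) h] with s hs hxs
        exact lt_asymm hs.1 hxs.1
      · exact absurd (Subtype.ext h ▸ hx) ht
      · exact Eventually.of_forall fun s hs => hs.2.not_gt h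
    filter_upwards [Ioo_mem_nhdsLT t.2.1, hev] with s hs hFs
    exact hF s t hs.1.le hs.2 t.2.2 hFs
  have htail : |J - ∑ t ∈ F, j (t : ℝ)| ≤ ε / 4 := by
    refine le_of_tendsto (((hJ : Tendsto _ _ _).sub_const (∑ t ∈ F, j (t : ℝ))).abs) ?_
    simp only [SummationFilter.unconditional_filter]
    filter_upwards [eventually_ge_atTop F] with G hG
    rw [← Finset.sum_sdiff hG, add_sub_cancel_right]
    refine (Finset.abs_sum_le_sum_abs _ _).trans (le_trans ?_ hδε.le)
    refine (Finset.sum_le_sum fun (t : Set.Ioc 0 T) ht => hjle δ t t.2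
      (hsmall t (Finset.mem_sdiff.1 ht).2)).trans ?_
    rw [← Finset.mul_sum]
    exact mul_le_mul_of_nonneg_left (hjump _) (by positivity)
  -- Just to the left of a point `t` of `F`, the term `g (X s) (X t)` is close to the jump term.
  set η : ℝ := ε / (4 * (F.card + 1)) with hη
  have hη0 : 0 < η := by positivity
  have hr : ∀ t : Set.Ioc 0 T, ∃ r ∈ Set.Ico 0 (t : ℝ), ∀ s ∈ Set.Ico r (t : ℝ),
      |g (X s) (X t) - j t| ≤ η := by
    intro t
    have h1 : Tendsto X (𝓝[<] (t : ℝ)) (𝓝[Set.Icc m M] (Function.leftLim X t)) := by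
      refine tendsto_nhdsWithin_iff.2 ⟨hX.tendsto_leftLim t.2.1 t.2.2, ?_⟩
      filter_upwards [Ioo_mem_nhdsLT t.2.1] with s hs
      exact hXS s ⟨hs.1.le, hs.2.le.trans t.2.2⟩
    have h2 := (hgc _ (hIcc t t.2) _ (hlim t t.2)).tendsto.comp h1
    obtain ⟨l, hl, h⟩ := mem_nhdsLT_iff_exists_Ico_subset.1
      (h2 (Metric.closedBall_mem_nhds _ hη0))
    exact ⟨max l 0, ⟨le_max_right _ _, max_lt hl t.2.1⟩,
      fun s hs => h ⟨(le_max_left _ _).trans hs.1, hs.2⟩⟩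
  choose r hr0 hr using hr
  obtain ⟨π₀, hπ₀⟩ := IntervalPartition.exists_finset_subset_range hT
    (F.image Subtype.val ∪ F.image r) (by
      intro x hx
      rcases Finset.mem_union.1 hx with hx | hx
      · obtain ⟨t, _, rfl⟩ := Finset.mem_image.1 hx
        exact ⟨t.2.1.le, t.2.2⟩
      · obtain ⟨t, _, rfl⟩ := Finset.mem_image.1 hx
        exact ⟨(hr0 t).1, (hr0 t).2.le.trans t.2.2⟩)
  refine ⟨π₀, fun π hπ => ?_⟩
  have hFπ : ∀ t : Set.Ioc 0 T, t ∈ F → (t : ℝ) ∈ Set.range π.t := fun t ht =>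
    hπ (hπ₀ (by simpa using Or.inl ⟨t.2, ht⟩))
  have hrπ : ∀ t ∈ F, r t ∈ Set.range π.t := fun t ht =>
    hπ (hπ₀ (Finset.mem_union_right _ (Finset.mem_image_of_mem r ht)))
  have hgap : ∀ (i : Fin π.N) (x : ℝ), x ∈ Set.range π.t → x < π.t i.succ →
      x ≤ π.t i.castSucc := by
    rintro i _ ⟨k, rfl⟩ hk
    exact π.strictMono.monotone (Fin.le_castSucc_iff.2 (π.strictMono.lt_iff_lt.1 hk))
  set e : Fin π.N → Set.Ioc 0 T := fun i =>
    ⟨π.t i.succ, (π.nonneg _).trans_lt (π.castSucc_lt_succ i), π.le_right _⟩ with he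
  have hinj : Function.Injective e := fun a b hab =>
    Fin.succ_injective _ (π.strictMono.injective (congrArg Subtype.val hab))
  set A : Finset (Fin π.N) := Finset.univ.filter fun i => e i ∈ F with hA
  have himage : A.image e = F := by
    ext t
    simp only [Finset.mem_image, hA, Finset.mem_filter, Finset.mem_univ, true_and]
    refine ⟨by rintro ⟨i, hi, rfl⟩; exact hi, fun ht => ?_⟩
    obtain ⟨k, hk⟩ := hFπ t ht
    have hk0 : k ≠ 0 := by
      rintro rfl
      rw [π.first] at hk
      exact t.2.1.ne hk
    have hek : e (k.pred hk0) = t := Subtype.ext (by simp [he, hk])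
    exact ⟨k.pred hk0, hek.symm ▸ ht, hek⟩
  have hcard : A.card = F.card := by rw [← himage, Finset.card_image_of_injective _ hinj]
  have hsumF : ∑ t ∈ F, j (t : ℝ) = ∑ i ∈ A, j (π.t i.succ) := by
    rw [← himage, Finset.sum_image hinj.injOn]
  have hmain : |∑ i ∈ A, g (X (π.t i.castSucc)) (X (π.t i.succ)) - ∑ t ∈ F, j (t : ℝ)| ≤ ε / 4 := by
    rw [hsumF, ← Finset.sum_sub_distrib]
    refine (Finset.abs_sum_le_sum_abs _ _).trans ?_
    have : ∀ i ∈ A, |g (X (π.t i.castSucc)) (X (π.t i.succ)) - j (π.t i.succ)| ≤ η := by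
      intro i hi
      have hiF : e i ∈ F := (Finset.mem_filter.1 hi).2
      exact hr (e i) _ ⟨hgap i _ (hrπ _ hiF) (hr0 (e i)).2, π.castSucc_lt_succ i⟩
    refine (Finset.sum_le_card_nsmul _ _ _ this).trans ?_
    rw [hcard, nsmul_eq_mul, hη, mul_div_assoc', div_le_div_iff₀ (by positivity) (by positivity)]
    nlinarith
  have hrest : |∑ i ∈ Aᶜ, g (X (π.t i.castSucc)) (X (π.t i.succ))| ≤ ε / 4 := by
    refine (Finset.abs_sum_le_sum_abs _ _).trans (le_trans ?_ hδε.le)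
    have hmem : ∀ k, X (π.t k) ∈ Set.Icc m M := fun k => hXS _ ⟨π.nonneg k, π.le_right k⟩
    have hterm : ∀ i ∈ Aᶜ, |g (X (π.t i.castSucc)) (X (π.t i.succ))| ≤
        C * δ ^ (q - p) * (v (π.t i.succ) - v (π.t i.castSucc)) := by
      intro i hi
      have hiF : e i ∉ F := fun h => Finset.mem_compl.1 hi (by simpa [hA] using h)
      have hδi : |X (π.t i.succ) - X (π.t i.castSucc)| ≤ δ := by
        refine hF _ _ (π.nonneg _) (π.castSucc_lt_succ i) (π.le_right _) fun x hx hxi => ?_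
        rcases hxi.2.eq_or_lt with h | h
        · exact hiF ((Subtype.ext h : x = e i) ▸ hx)
        · exact (hgap i x (hFπ x hx) h).not_gt hxi.1
      refine (hg _ (hmem _) _ (hmem _)).trans ?_
      rw [mul_assoc]
      refine mul_le_mul_of_nonneg_left ((rpow_abs_le_of_abs_le hp hpq hδi).trans ?_) hC
      exact mul_le_mul_of_nonneg_left
        (hv _ _ (π.nonneg _) (π.castSucc_lt_succ i).le (π.le_right _)) (by positivity)
    refine (Finset.sum_le_sum hterm).trans ?_
    rw [← Finset.mul_sum]
    refine mul_le_mul_of_nonneg_left ?_ (by positivity)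
    rw [hV, ← π.sum_sub v]
    exact Finset.sum_le_univ_sum_of_nonneg fun i => sub_nonneg.2
      (hv.monotone (π.nonneg _) (π.castSucc_lt_succ i).le (π.le_right _))
  have hsplit : riemannSum (fun s t => g (X s) (X t)) π =
      ∑ i ∈ A, g (X (π.t i.castSucc)) (X (π.t i.succ)) +
        ∑ i ∈ Aᶜ, g (X (π.t i.castSucc)) (X (π.t i.succ)) := (Finset.sum_add_sum_compl A _).symm
  rw [hsplit]
  rw [abs_le] at hmain hrest htail
  rw [abs_lt]
  constructor <;> linarith [hmain.1, hmain.2, hrest.1, hrest.2, htail.1, htail.2]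

/-! ### The reduced lift of a path and its controlled gradients -/

theorem abs_pow_div_factorial_rpow_le {p : ℝ} (hp : 0 < p) {k : ℕ} (hk : k ≠ 0) (x : ℝ) :
    |x ^ k / (k.factorial : ℝ)| ^ (p / (k : ℝ)) ≤ |x| ^ p := by
  have hk' : (0 : ℝ) < k := by exact_mod_cast Nat.pos_of_ne_zero hk
  have h1 : |x ^ k / (k.factorial : ℝ)| ≤ |x| ^ k := by
    rw [abs_div, abs_pow, Nat.abs_cast]
    exact div_le_self (by positivity) (by exact_mod_cast k.factorial_pos)
  refine (Real.rpow_le_rpow (abs_nonneg _) h1 (by positivity)).trans (le_of_eq ?_)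
  rw [← Real.rpow_natCast, ← Real.rpow_mul (abs_nonneg x), mul_div_cancel₀ _ hk'.ne']

/-- The lift of a path of finite `p`-variation is a reduced rough path; Chen's relation is the
binomial theorem. -/
theorem isReducedRoughPath_reducedLift {p T : ℝ} (hp : 0 < p) {X v : ℝ → ℝ}
    (hv : IsVariationControl p T X v) : IsReducedRoughPath p T (reducedLift X) where
  zero s t _ _ _ := by simp [reducedLift]
  control := by
    refine ⟨fun s t => ⌊p⌋₊ * (v t - v s), ⟨?_, ?_, ?_⟩, ?_⟩
    · intro s t hs hst ht
      exact mul_nonneg (Nat.cast_nonneg _) (sub_nonneg.2 (hv.monotone hs hst ht))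
    · intro t _ _
      simp
    · intro s u t _ _ _ _
      exact le_of_eq (by ring)
    · intro s t hs hst ht
      refine (Finset.sum_le_card_nsmul _ _ (v t - v s) fun k hk => ?_).trans (by simp)
      exact (abs_pow_div_factorial_rpow_le hp
        (Nat.one_le_iff_ne_zero.1 (Finset.mem_Icc.1 hk).1) _).trans (hv s t hs hst ht)
  chen := by
    intro k _ s u t _ _ _ _
    have h : increment X s t = increment X u t + increment X s u := by
      simp only [increment]
      ring
    simp only [reducedLift, h, add_pow, Finset.sum_div]
    refine Finset.sum_congr rfl fun j hj => ?_
    have hjk : j ≤ k := Nat.lt_succ_iff.1 (Finset.mem_range.1 hj)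
    rw [Nat.cast_choose ℝ hjk]
    have h1 : (k.factorial : ℝ) ≠ 0 := by positivity
    have h2 : (j.factorial : ℝ) ≠ 0 := by positivity
    have h3 : ((k - j).factorial : ℝ) ≠ 0 := by positivity
    field_simp

/-- For the lift of a path, the remainder of a gradient path is a Taylor remainder. -/
theorem controlledRemainder_gradientPath (p : ℝ) (F : ℝ → ℝ) (X : ℝ → ℝ) {i : ℕ}
    (hi : i < ⌊p⌋₊) (s t : ℝ) :
    controlledRemainder p (reducedLift X) (gradientPath F X) i s t =
      iteratedDeriv (i + 1) F (X t) - ∑ j ∈ Finset.range (⌊p⌋₊ - i),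
        iteratedDeriv (i + 1 + j) F (X s) * ((X t - X s) ^ j / (j.factorial : ℝ)) := by
  have h : ⌊p⌋₊ - i = ⌊p⌋₊ - 1 - i + 1 := by omega
  rw [h, Finset.range_eq_Ico, Finset.sum_eq_sum_Ico_succ_bot (Nat.succ_pos _), ← sub_sub]
  simp [controlledRemainder, gradientPath, reducedLift, increment, add_right_comm,
    ← Finset.Ico_add_one_right_eq_Icc]

/-- The gradients of a smooth function along a path of finite `p`-variation are controlled by the
lift of the path. -/
theorem isReducedControlledPath_gradientPath {p T m M : ℝ} (hp : 0 < p) {X v : ℝ → ℝ}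
    (hv : IsVariationControl p T X v) (hXS : ∀ t ∈ Set.Icc 0 T, X t ∈ Set.Icc m M) {F : ℝ → ℝ}
    (hF : ∀ k, ∀ x ∈ Set.Icc m M,
      HasDerivAt (iteratedDeriv k F) (iteratedDeriv (k + 1) F x) x) :
    IsReducedControlledPath p T (reducedLift X) (gradientPath F X) := by
  intro i hi
  obtain ⟨C, hC0, hC⟩ := exists_taylor_bound hF (⌊p⌋₊ - i) (i + 1)
  have hcast : ((⌊p⌋₊ - i : ℕ) : ℝ) = (⌊p⌋₊ : ℝ) - i := Nat.cast_sub hi.le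
  have hpos : (0 : ℝ) < (⌊p⌋₊ : ℝ) - i := sub_pos.2 (by exact_mod_cast hi)
  set q : ℝ := p / ((⌊p⌋₊ : ℝ) - i) with hq
  have hq0 : 0 < q := div_pos hp hpos
  refine pVariation_lt_top_of_le hq0 (K := C ^ q) (v := v) fun s t hs hst ht => ?_
  rw [controlledRemainder_gradientPath p F X hi]
  refine (Real.rpow_le_rpow (abs_nonneg _)
    (hC _ (hXS s ⟨hs, hst.trans ht⟩) _ (hXS t ⟨hs.trans hst, ht⟩)) hq0.le).trans ?_
  rw [Real.mul_rpow hC0 (by positivity), ← Real.rpow_natCast, ← Real.rpow_mul (abs_nonneg _),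
    hcast, hq, mul_div_cancel₀ _ hpos.ne']
  exact mul_le_mul_of_nonneg_left (hv s t hs hst ht) (by positivity)

/-! ### The change of variables formula -/

/-- The Itô formula for reduced rough integrals along a càdlàg path of finite `p`-variation: the
correction at a jump is the Taylor remainder of order `⌊p⌋` across it. -/
theorem exists_hasReducedRoughIntegral_gradientPath {p T m M : ℝ} (hT : 0 ≤ T) (hp : 0 < p)
    {X v : ℝ → ℝ} (hX : IsCadlagOn T X) (hv : IsVariationControl p T X v)
    (hXS : ∀ t ∈ Set.Icc 0 T, X t ∈ Set.Icc m M) {F : ℝ → ℝ}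
    (hF : ∀ k, ∀ x ∈ Set.Icc m M,
      HasDerivAt (iteratedDeriv k F) (iteratedDeriv (k + 1) F x) x) :
    ∃ I J : ℝ,
      HasReducedRoughIntegral p T (reducedLift X) (gradientPath F X) I ∧
      HasSum (fun t : Set.Ioc 0 T => F (X t) - ∑ k ∈ Finset.range (⌊p⌋₊ + 1),
        iteratedDeriv k F (Function.leftLim X t) *
          (leftJump X t ^ k / (k.factorial : ℝ))) J ∧
      F (X T) - F (X 0) = I + J := by
  set g : ℝ → ℝ → ℝ := fun x y => F y - ∑ k ∈ Finset.range (⌊p⌋₊ + 1),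
    iteratedDeriv k F x * ((y - x) ^ k / (k.factorial : ℝ)) with hg
  obtain ⟨C, hC0, hC⟩ := exists_taylor_bound hF (⌊p⌋₊ + 1) 0
  obtain ⟨J, hJ, hlim⟩ := exists_hasSum_hasRRSLimit_of_abs_le (q := (⌊p⌋₊ + 1 : ℕ)) (g := g) hT hp
    (by push_cast; exact Nat.lt_floor_add_one p) hC0 hX hv hXS
    (fun x hx y hy => by rw [Real.rpow_natCast]; simpa [hg] using hC x hx y hy)
    (fun y _ => by
      refine continuousOn_const.sub (continuousOn_finsetSum _ fun k _ => ?_)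
      refine ContinuousOn.mul (fun x hx => (hF k x hx).continuousAt.continuousWithinAt) ?_
      fun_prop)
  refine ⟨F (X T) - F (X 0) - J, J, ⟨isReducedRoughPath_reducedLift hp hv,
    isReducedControlledPath_gradientPath hp hv hXS hF, fun ε hε => ?_⟩, hJ, by ring⟩
  obtain ⟨π₀, hπ₀⟩ := hlim ε hε
  refine ⟨π₀, fun π hπ => ?_⟩
  -- The compensated sums are telescoping sums minus Taylor remainders.
  have hsum : riemannSum (fun s t => ∑ k ∈ Finset.range ⌊p⌋₊,
      gradientPath F X k s * reducedLift X (k + 1) s t) π =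
      F (X T) - F (X 0) - riemannSum (fun s t => g (X s) (X t)) π := by
    rw [← π.sum_sub fun t => F (X t), riemannSum, riemannSum, ← Finset.sum_sub_distrib]
    refine Finset.sum_congr rfl fun i _ => ?_
    simp only [hg, Finset.sum_range_succ' _ ⌊p⌋₊, gradientPath, reducedLift, increment]
    simp
  rw [hsum, show ∀ a b c : ℝ, a - b - (a - c) = -(b - c) from fun a b c => by ring, abs_neg]
  exact hπ₀ π hπ

/-- The Taylor remainder of the logarithm across a jump, written in terms of the relative jump. -/
theorem logJumpCorrection_eq {p : ℝ} {X : ℝ → ℝ} {t : ℝ} (hx : 0 < Function.leftLim X t)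
    (hy : 0 < X t) :
    logJumpCorrection p X t = Real.log (X t) - ∑ k ∈ Finset.range (⌊p⌋₊ + 1),
      iteratedDeriv k Real.log (Function.leftLim X t) *
        (leftJump X t ^ k / (k.factorial : ℝ)) := by
  have h1 : 1 + leftJump X t / Function.leftLim X t = X t / Function.leftLim X t := by
    rw [leftJump]
    field_simp
    ring
  rw [logJumpCorrection, h1, Real.log_div hy.ne' hx.ne', Finset.sum_range_succ',
    ← Finset.Ico_add_one_right_eq_Icc, Finset.sum_Ico_eq_sum_range, Nat.add_sub_cancel]
  have h2 : ∀ k, (-1 : ℝ) ^ (1 + k - 1) / ((1 + k : ℕ) : ℝ) *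
      (leftJump X t / Function.leftLim X t) ^ (1 + k) =
      iteratedDeriv (k + 1) Real.log (Function.leftLim X t) *
        (leftJump X t ^ (k + 1) / ((k + 1).factorial : ℝ)) := by
    intro k
    have h3 : Function.leftLim X t ^ (-1 - k : ℤ) = (Function.leftLim X t ^ (k + 1))⁻¹ := by
      rw [← zpow_natCast, ← zpow_neg]
      congr 1
      push_cast
      ring
    rw [iteratedDeriv_succ_real_log, h3, Nat.factorial_succ, add_comm 1 k, Nat.add_sub_cancel,
      div_pow]
    push_cast
    have h4 : (k.factorial : ℝ) ≠ 0 := by positivity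
    have h5 : (k : ℝ) + 1 ≠ 0 := by positivity
    field_simp
  simp only [h2]
  simp
  ring

theorem mainTheorem6 {Ω : Type*} [MeasurableSpace Ω] (P : Measure Ω) [IsProbabilityMeasure P]
    (T : ℝ) (hT : 0 ≤ T) (p : ℝ) (hp : 1 ≤ p) (W : ℝ → Ω → ℝ)
    (hcadlag : ∀ᵐ ω ∂P, IsCadlagOn T (fun t => W t ω))
    (hvar : ∀ᵐ ω ∂P, pVariation p T (increment (fun t => W t ω)) < ∞)
    (hrange : ∀ᵐ ω ∂P, ∃ m M : ℝ, 0 < m ∧ ∀ t ∈ Set.Icc 0 T, W t ω ∈ Set.Icc m M) :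
    ∀ᵐ ω ∂P, ∃ I J : ℝ,
      HasReducedRoughIntegral p T (reducedLift (fun t => W t ω))
        (gradientPath Real.log (fun t => W t ω)) I ∧
      HasSum (fun t : Set.Ioc 0 T => logJumpCorrection p (fun t => W t ω) t) J ∧
      Real.log (W T ω) - Real.log (W 0 ω) = I + J := by
  filter_upwards [hcadlag, hvar, hrange] with ω hX hV ⟨m, M, hm, hXS⟩
  have hp0 : 0 < p := one_pos.trans_le hp
  obtain ⟨v, hv⟩ := exists_isVariationControl hp0 hV
  obtain ⟨I, J, hI, hJ, hIJ⟩ := exists_hasReducedRoughIntegral_gradientPath hT hp0 hX hv hXS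
    fun k x hx => hasDerivAt_iteratedDeriv_log k (hm.trans_le hx.1)
  refine ⟨I, J, hI, ?_, hIJ⟩
  convert! hJ using 2 with t
  exact logJumpCorrection_eq
    (hm.trans_le (hX.leftLim_mem isClosed_Icc hXS t.2.1 t.2.2).1)
    (hm.trans_le (hXS t ⟨t.2.1.le, t.2.2⟩).1)
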